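/- Let $p\colon E\to B$ be a locally trivial fibration with path-connected (in particular non-empty) fibre $X$, where $E$ and $B$ are metrisable and $B\neq\emptyset$. Assume that $X$ is semi-locally contractible: every point of $X$ has a neighbourhood $V$ such that the inclusion $V\hookrightarrow X$ is null-homotopic (this holds, for example, if $X$ or $E\times_B E$ is locally contractible). Then $$\mathrm{TC}[p\colon E\to B]\;\le\; 2\dim X+\dim B .$$ Here $\mathrm{TC}[p\colon E\to B]\in\{0,1,2,\dots,\infty\}$ is the parametrised topological complexity: with $E\times_B E=\{(e,e')\in E\times E : p(e)=p(e')\}$ and $E^I_B$ the space (with the compact-open topology) of continuous paths $\gamma\colon[0,1]\to E$ for which $p\circ\gamma$ is constant, it is the least $k\ge 0$ such that $E\times_B E$ has an open cover $U_0\cup\dots\cup U_k$ and, for each $i$, there is a continuous map $s_i\colon U_i\to E^I_B$ with $s_i(e,e')(0)=e$ and $s_i(e,e')(1)=e'$ for all $(e,e')\in U_i$ (and $\infty$ if there is no such $k$). The covering dimension $\dim Y\in\{0,1,2,\dots,\infty\}$ of a non-empty space $Y$ is the least $n$ such that every open cover of $Y$ has an open refinement in which every point of $Y$ lies in at most $n+1$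 members (and $\infty$ if there is no such $n$). -/

import Mathlib

open scoped Topology unitInterval

/-- `Y` has covering dimension at most `n`: every open cover of `Y` has an open refinement such
that every point of `Y` lies in at most `n + 1` members of the refinement. -/
def HasCoveringDimLE (Y : Type*) [TopologicalSpace Y] (n : ℕ) : Prop :=
  ∀ 𝒰 : Set (Set Y), (∀ U ∈ 𝒰, IsOpen U) → ⋃₀ 𝒰 = Set.univ →
    ∃ 𝒱 : Set (Set Y), (∀ V ∈ 𝒱, IsOpen V) ∧ ⋃₀ 𝒱 = Set.univ ∧
      (∀ V ∈ 𝒱, ∃ U ∈ 𝒰, V ⊆ U) ∧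
      ∀ y : Y, {V ∈ 𝒱 | y ∈ V}.encard ≤ (n : ℕ∞) + 1

/-- The (Lebesgue) covering dimension of a nonempty topological space, with value `⊤` if there is
no finite bound. (The empty space, to which one assigns dimension `-1`, is not considered here.) -/
noncomputable def coveringDim (Y : Type*) [TopologicalSpace Y] : ℕ∞ :=
  ⨅ (n : ℕ) (_ : HasCoveringDimLE Y n), (n : ℕ∞)

/-- The base of `q : Z → Y` admits an open cover `U₀, …, U_k`, each member of which admits a
continuous section of `q`. -/
def HasSectionalCover {Z Y : Type*} [TopologicalSpace Z] [TopologicalSpace Y] (q : Z → Y)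
    (k : ℕ) : Prop :=
  ∃ U : Fin (k + 1) → Set Y, (∀ i, IsOpen (U i)) ∧ ⋃ i, U i = Set.univ ∧
    ∀ i, ∃ s : C(U i, Z), ∀ y : U i, q (s y) = y

/-- The sectional category (normalised Schwarz genus) of `q`: the smallest `k` such that the base
has a cover by `k + 1` open sets with continuous sections, and `⊤` if there is no such `k`. -/
noncomputable def sectionalCategory {Z Y : Type*} [TopologicalSpace Z] [TopologicalSpace Y]
    (q : Z → Y) : ℕ∞ :=
  ⨅ (k : ℕ) (_ : HasSectionalCover q k), (k : ℕ∞)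

/-- `p : E → B` is a locally trivial fibration with fibre `X`: every point of `B` has an open
neighbourhood over which `p` is homeomorphic to the projection from the product with `X`. -/
def IsLocallyTrivialFibration {E B : Type*} (X : Type*) [TopologicalSpace E] [TopologicalSpace B]
    [TopologicalSpace X] (p : E → B) : Prop :=
  ∀ b : B, ∃ e : Bundle.Trivialization X p, b ∈ e.baseSet

/-- The space of continuous paths in `E` lying in a single fibre of `p`, with the topology induced
by the compact-open topology. -/
abbrev FibrewisePath {E B : Type*} [TopologicalSpace E] (p : E → B) : Type _ :=
  {γ : C(I, E) // ∀ t, p (γ t) = p (γ 0)}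

/-- The map sending a path in a single fibre of `p` to its pair of endpoints in the fibre product
`E ×_B E = {(e, e') | p e = p e'}`, the latter with the topology induced from `E × E`. -/
def fibrewiseEndpoints {E B : Type*} [TopologicalSpace E] (p : E → B) (γ : FibrewisePath p) :
    {z : E × E // p z.1 = p z.2} :=
  ⟨(γ.1 0, γ.1 1), (γ.2 1).symm⟩

/-- The parametrised topological complexity of `p`. -/
noncomputable def parametrizedTC {E B : Type*} [TopologicalSpace E] (p : E → B) : ℕ∞ :=
  sectionalCategory (fibrewiseEndpoints p)

/-- Every point of `X` has a neighbourhood whose inclusion into `X` is null-homotopic. This follows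
from local contractibility. -/
def SemilocallyContractible (X : Type*) [TopologicalSpace X] : Prop :=
  ∀ x : X, ∃ V ∈ 𝓝 x, (⟨Subtype.val, continuous_subtype_val⟩ : C(V, X)).Nullhomotopic

/-! Near every point of `E ×_B E` the endpoint map has a section: in a trivialising chart, contract
both fibre coordinates and join the two contraction points by a fixed path. Over a zero-dimensional
subset every open cover has a refinement by disjoint relatively open pieces, so such local sections
glue there; by metrisability the glued section extends to an open neighbourhood
(`hasSectionalCover_of_zeroDimOn`). With `n` and `d` bounding the dimensions of `X` and `B`, it
remains to write `E ×_B E` as a union of `2 * n + d + 1` zero-dimensional sets.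

This is the decomposition theorem of dimension theory, in a form that adds up in products. A
metrisable space of dimension at most `n` carries a rank with values in `0, …, n`, zero-dimensional
levels and F_σ superlevel sets (`HasCoveringDimLE.exists_isDimRank`): take coloured covers of mesh
tending to zero, put their members in general position, and count the frontiers through a point. By
the countable sum theorem (`ZeroDimOn.of_countable_cover`) ranks add in products, so `B × X × X` has
a rank bounded by `d + 2 * n`. Charts over the pieces of a finite closed cover of `B` carry its
levels to `E ×_B E`, where the sum theorem reassembles them. -/

open Set Filter

/-! ### Locally constant functions on subspaces -/

/-- The restriction of `f` to `Z` is locally constant. -/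
def LocConstOn {Y α : Type*} [TopologicalSpace Y] (f : Y → α) (Z : Set Y) : Prop :=
  ∀ x ∈ Z, ∀ᶠ y in 𝓝[Z] x, f y = f x

theorem LocConstOn.mono {Y α : Type*} [TopologicalSpace Y] {f : Y → α} {Z W : Set Y}
    (h : LocConstOn f Z) (hW : W ⊆ Z) : LocConstOn f W := fun x hx =>
  (h x (hW hx)).filter_mono (nhdsWithin_mono x hW)

theorem LocConstOn.comp_left {Y α β : Type*} [TopologicalSpace Y] {f : Y → α} {Z : Set Y}
    (h : LocConstOn f Z) (g : α → β) : LocConstOn (fun y => g (f y)) Z := fun x hx =>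
  (h x hx).mono fun _ hy => congrArg g hy

theorem LocConstOn.isOpen {Y α : Type*} [TopologicalSpace Y] {f : Y → α} {Z : Set Y}
    (h : LocConstOn f Z) (hZ : IsOpen Z) {P : α → Set Y} (hP : ∀ a, IsOpen (P a)) :
    IsOpen {y ∈ Z | y ∈ P (f y)} := by
  rw [isOpen_iff_mem_nhds]
  rintro x ⟨hx, hxP⟩
  have h1 := h x hx
  rw [hZ.nhdsWithin_eq hx] at h1
  filter_upwards [h1, hZ.mem_nhds hx, (hP (f x)).mem_nhds hxP] with y hy hyZ hyP
  exact ⟨hyZ, by rw [hy]; exact hyP⟩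

/-- Around each point of `K` take the ball of half the radius on which `f` is constant along `K`. If
two such balls meet, the centre of one lies in the full ball of the other, so the values agree and
spread consistently over the union. -/
theorem LocConstOn.extend {Y α : Type*} [TopologicalSpace Y] [TopologicalSpace.MetrizableSpace Y]
    {f : Y → α} {K : Set Y} (h : LocConstOn f K) :
    ∃ (O : Set Y) (g : Y → α), IsOpen O ∧ K ⊆ O ∧ LocConstOn g O ∧ EqOn g f K := by
  classical
  let _ := TopologicalSpace.metrizableSpaceMetric Y
  have h1 : ∀ x, ∃ ε > 0, x ∈ K → ∀ y ∈ K, dist y x < ε → f y = f x := by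
    intro x
    by_cases hx : x ∈ K
    · obtain ⟨ε, hε, H⟩ := Metric.mem_nhdsWithin_iff.1 (h x hx)
      exact ⟨ε, hε, fun _ y hy hd => H ⟨hd, hy⟩⟩
    · exact ⟨1, one_pos, fun h => absurd h hx⟩
  choose ε hε H using h1
  have key : ∀ x ∈ K, ∀ x' ∈ K, ∀ y, dist y x < ε x / 2 → dist y x' < ε x' / 2 →
      f x = f x' := by
    intro x hx x' hx' y hd hd'
    have h3 : dist x x' ≤ dist y x + dist y x' := dist_triangle_left x x' y
    rcases le_total (ε x) (ε x') with hle | hle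
    · exact H x' hx' x hx (by linarith)
    · exact (H x hx x' hx' (by rw [dist_comm]; linarith)).symm
  let g : Y → α := fun y => if hy : ∃ x ∈ K, dist y x < ε x / 2 then f hy.choose else f y
  have hg : ∀ x ∈ K, ∀ y, dist y x < ε x / 2 → g y = f x := by
    intro x hx y hd
    have hy : ∃ x ∈ K, dist y x < ε x / 2 := ⟨x, hx, hd⟩
    simp only [g, dif_pos hy]
    exact key _ hy.choose_spec.1 _ hx y hy.choose_spec.2 hd
  refine ⟨⋃ x ∈ K, Metric.ball x (ε x / 2), g, ?_, ?_, ?_, ?_⟩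
  · exact isOpen_biUnion fun x _ => Metric.isOpen_ball
  · intro x hx
    exact mem_biUnion hx (Metric.mem_ball_self (half_pos (hε x)))
  · intro y hy
    obtain ⟨x, hx, hd⟩ := mem_iUnion₂.1 hy
    filter_upwards [mem_nhdsWithin_of_mem_nhds (Metric.isOpen_ball.mem_nhds hd)] with z hz
    rw [hg x hx z hz, hg x hx y hd]
  · intro x hx
    exact hg x hx x (by simpa using half_pos (hε x))

theorem LocConstOn.union {Y α : Type*} [TopologicalSpace Y] {f : Y → α} {C D : Set Y}
    (hC : IsClosed C) (hD : IsClosed D) (h : LocConstOn f C) (h' : LocConstOn f D) :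
    LocConstOn f (C ∪ D) := by
  intro x _
  rw [nhdsWithin_union, eventually_sup]
  constructor
  · by_cases hx : x ∈ C
    · exact h x hx
    · rw [notMem_closure_iff_nhdsWithin_eq_bot.1 (by rwa [hC.closure_eq])]; exact eventually_bot
  · by_cases hx : x ∈ D
    · exact h' x hx
    · rw [notMem_closure_iff_nhdsWithin_eq_bot.1 (by rwa [hD.closure_eq])]; exact eventually_bot

/-! ### Coloured covers and general position of frontiers -/

/-- A space of covering dimension at most `n` is covered by `n + 1` open sets, each of which is a
disjoint union of open sets subordinate to a given cover. -/
theorem HasCoveringDimLE.exists_coloring {X : Type*} [TopologicalSpace X]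
    [TopologicalSpace.MetrizableSpace X] {n : ℕ} (hX : HasCoveringDimLE X n) (N : X → Set X)
    (hN : ∀ x, IsOpen (N x)) (hxN : ∀ x, x ∈ N x) :
    ∃ (O : Fin (n + 1) → Set X) (f : Fin (n + 1) → X → X), (∀ j, IsOpen (O j)) ∧
      (⋃ j, O j = univ) ∧ (∀ j, LocConstOn (f j) (O j)) ∧ ∀ j, ∀ x ∈ O j, x ∈ N (f j x) := by
  classical
  let _ := TopologicalSpace.metrizableSpaceMetric X
  obtain ⟨𝒱, hVo, hVc, hVr, hVn⟩ := hX (range N) (by rintro _ ⟨x, rfl⟩; exact hN x)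
    (eq_univ_of_forall fun x => ⟨N x, ⟨x, rfl⟩, hxN x⟩)
  have hVr' : ∀ V : 𝒱, ∃ x, (V : Set X) ⊆ N x := by
    rintro ⟨V, hV⟩
    obtain ⟨_, ⟨x, rfl⟩, h⟩ := hVr V hV
    exact ⟨x, h⟩
  choose c hc using hVr'
  obtain ⟨φ, hφ⟩ := PartitionOfUnity.exists_isSubordinate (s := (univ : Set X)) isClosed_univ
    (fun V : 𝒱 => (V : Set X)) (fun V => hVo V V.2) (by
      rw [← sUnion_eq_iUnion, hVc])
  have hφV : ∀ (V : 𝒱) x, φ V x ≠ 0 → x ∈ (V : Set X) := fun V x h =>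
    hφ V (subset_tsupport _ h)
  have hfin : ∀ x, {V : 𝒱 | φ V x ≠ 0}.Finite := fun x => φ.locallyFinite.point_finite x
  have hcard : ∀ x (S : Finset 𝒱), (∀ V ∈ S, φ V x ≠ 0) → S.card ≤ n + 1 := by
    intro x S hS
    have h1 : ((S.map (Function.Embedding.subtype _) : Finset (Set X)) : Set (Set X)) ⊆
        {V ∈ 𝒱 | x ∈ V} := by
      intro V hV
      simp only [Finset.coe_map, mem_image] at hV
      obtain ⟨V, hV, rfl⟩ := hV
      exact ⟨V.2, hφV V x (hS V hV)⟩
    have h2 := (encard_le_encard h1).trans (hVn x)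
    rw [encard_coe_eq_coe_finsetCard, Finset.card_map] at h2
    exact_mod_cast h2
  -- `W S` is where the members of `S` strictly dominate all others in the partition of unity. Two
  -- different `S` of equal size exclude each other, and the set of maximisers at `x` always
  -- qualifies.
  let W : Finset 𝒱 → Set X := fun S => {x | ∀ V ∈ S, 0 < φ V x ∧ ∀ V' ∉ S, φ V' x < φ V x}
  have hWo : ∀ S, IsOpen (W S) := by
    intro S
    rw [isOpen_iff_mem_nhds]
    intro x hx
    obtain ⟨t, ht, hfint⟩ := φ.locallyFinite x
    have e1 : ∀ᶠ y in 𝓝 x, ∀ V ∈ S, 0 < φ V y := by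
      rw [Filter.eventually_all_finset]
      exact fun V hV => (φ V).continuous.continuousAt.eventually
        (lt_mem_nhds (hx V hV).1)
    have e2 : ∀ᶠ y in 𝓝 x, ∀ V ∈ S, ∀ V' ∈ hfint.toFinset, V' ∉ S → φ V' y < φ V y := by
      rw [Filter.eventually_all_finset]
      intro V hV
      rw [Filter.eventually_all_finset]
      intro V' _
      by_cases hS : V' ∈ S
      · exact Eventually.of_forall fun _ h => absurd hS h
      · filter_upwards [(φ V').continuous.continuousAt.eventually_lt
          (φ V).continuous.continuousAt ((hx V hV).2 V' hS)] with y hy _ using hy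
    filter_upwards [e1, e2, ht] with y h1 h2 hyt V hV
    refine ⟨h1 V hV, fun V' hV' => ?_⟩
    by_cases h0 : φ V' y = 0
    · rw [h0]; exact h1 V hV
    · exact h2 V hV V' (by rw [Finite.mem_toFinset]; exact ⟨y, h0, hyt⟩) hV'
  have hWd : ∀ x S S', x ∈ W S → x ∈ W S' → S.card = S'.card → S = S' := by
    intro x S S' h h' hcd
    by_contra hne
    have h1 : ¬ S ⊆ S' := fun hs => hne (Finset.eq_of_subset_of_card_le hs hcd.ge)
    have h2 : ¬ S' ⊆ S := fun hs => hne (Finset.eq_of_subset_of_card_le hs hcd.le).symm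
    obtain ⟨V, hV, hV'⟩ := Finset.not_subset.1 h1
    obtain ⟨U, hU, hU'⟩ := Finset.not_subset.1 h2
    exact lt_asymm ((h V hV).2 U hU') ((h' U hU).2 V hV')
  have hWc : ∀ x, ∃ S : Finset 𝒱, S.Nonempty ∧ x ∈ W S := by
    intro x
    obtain ⟨V₀, hV₀⟩ := φ.exists_pos (mem_univ x)
    obtain ⟨M, hM, hmax⟩ := (hfin x).toFinset.exists_max_image (fun V => φ V x)
      ⟨V₀, by simpa using hV₀.ne'⟩
    have hmax' : ∀ V, φ V x ≤ φ M x := by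
      intro V
      by_cases h0 : φ V x = 0
      · rw [h0]; exact φ.nonneg M x
      · exact hmax V (by simpa using h0)
    have hMpos : 0 < φ M x := hV₀.trans_le (hmax' V₀)
    refine ⟨(hfin x).toFinset.filter (fun V => φ V x = φ M x), ⟨M, by simp; exact hMpos.ne'⟩, ?_⟩
    intro V hV
    have hVM := (Finset.mem_filter.1 hV).2
    refine ⟨by rw [hVM]; exact hMpos, fun V' hV' => ?_⟩
    rw [hVM]
    refine lt_of_le_of_ne (hmax' V') fun he => hV' ?_
    simp only [Finset.mem_filter, Finite.mem_toFinset, mem_ofPred_eq]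
    exact ⟨by rw [he]; exact hMpos.ne', he⟩
  -- The colour is the size of `S` minus one: at most `n + 1` functions are nonzero at a point, and
  -- `S` is nonempty.
  let O : Fin (n + 1) → Set X := fun j => ⋃ (S : Finset 𝒱) (_ : S.card = j + 1), W S
  let f : Fin (n + 1) → X → X := fun j x =>
    if h : ∃ S : Finset 𝒱, S.card = j + 1 ∧ x ∈ W S then
      (if h' : h.choose.Nonempty then c h'.choose else x) else x
  have aux : ∀ {S S' : Finset 𝒱} (_ : S = S') (h : S.Nonempty) (h' : S'.Nonempty),
      h.choose = h'.choose := by rintro S _ rfl _ _; rfl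
  have hf : ∀ (j : Fin (n + 1)) (x : X) (S : Finset 𝒱), S.card = (j : ℕ) + 1 → x ∈ W S → ∃ V ∈ S, ∀ y ∈ W S,
      f j y = c V := by
    intro j x S hS _
    have hne : S.Nonempty := by rw [← Finset.card_pos]; omega
    refine ⟨hne.choose, hne.choose_spec, fun y hy => ?_⟩
    have h : ∃ S : Finset 𝒱, S.card = j + 1 ∧ y ∈ W S := ⟨S, hS, hy⟩
    have he : h.choose = S := hWd y _ _ h.choose_spec.2 hy (h.choose_spec.1.trans hS.symm)
    have hne' : h.choose.Nonempty := he ▸ hne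
    simp only [f, dif_pos h, dif_pos hne']
    exact congrArg c (aux he _ _)
  refine ⟨O, f, fun j => isOpen_iUnion fun S => isOpen_iUnion fun _ => hWo S, ?_, ?_, ?_⟩
  · refine eq_univ_of_forall fun x => ?_
    obtain ⟨S, hne, hxS⟩ := hWc x
    have h1 := hcard x S fun V hV => (hxS V hV).1.ne'
    have h2 := hne.card_pos
    exact mem_iUnion.2 ⟨⟨S.card - 1, by omega⟩, mem_iUnion₂.2 ⟨S, by simp; omega, hxS⟩⟩
  · intro j x hx
    obtain ⟨S, hS, hxS⟩ := mem_iUnion₂.1 hx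
    obtain ⟨V, hV, H⟩ := hf j x S hS hxS
    filter_upwards [mem_nhdsWithin_of_mem_nhds ((hWo S).mem_nhds hxS)] with y hy
    rw [H y hy, H x hxS]
  · intro j x hx
    obtain ⟨S, hS, hxS⟩ := mem_iUnion₂.1 hx
    obtain ⟨V, hV, H⟩ := hf j x S hS hxS
    rw [H x hxS]
    exact hc V (hφV V x (hxS V hV).1.ne')

/-- There are as many colours as pairs, so colour `i` can serve pair `i`. Each piece of a fine
enough cover lies in `U i` or misses `F i`; the pieces of colour `i` are sorted accordingly, and the
resulting finite open cover is shrunk to a closed one. -/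
theorem HasCoveringDimLE.exists_closed_separators {X : Type*} [TopologicalSpace X]
    [TopologicalSpace.MetrizableSpace X] {n : ℕ} (hX : HasCoveringDimLE X n)
    (F U : Fin (n + 1) → Set X) (hF : ∀ i, IsClosed (F i)) (hU : ∀ i, IsOpen (U i))
    (hFU : ∀ i, F i ⊆ U i) :
    ∃ A D : Fin (n + 1) → Set X, (∀ i, IsClosed (A i)) ∧ (∀ i, IsClosed (D i)) ∧
      (∀ i, A i ⊆ U i) ∧ (∀ i, Disjoint (D i) (F i)) ∧ (∀ i, Disjoint (A i) (D i)) ∧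
      ∀ x, ∃ i, x ∈ A i ∨ x ∈ D i := by
  classical
  obtain ⟨O, f, hO, hOc, hf, hfN⟩ := hX.exists_coloring
    (fun x => ⋂ i, if x ∈ U i then U i else (F i)ᶜ)
    (fun x => isOpen_iInter_of_finite fun i => by
      split_ifs
      exacts [hU i, (hF i).isOpen_compl])
    (fun x => mem_iInter.2 fun i => by
      split_ifs with h
      exacts [h, fun h' => h (hFU i h')])
  let V : Fin (n + 1) × Bool → Set X := fun q =>
    {x ∈ O q.1 | x ∈ {_y : X | (f q.1 x ∈ U q.1) ↔ q.2 = true}}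
  have hV : ∀ q, IsOpen (V q) := fun q => (hf q.1).isOpen (hO q.1)
    (P := fun a => {_y : X | (a ∈ U q.1) ↔ q.2 = true}) (fun a => isOpen_const)
  have hVc : ⋃ q, V q = univ := by
    refine eq_univ_of_forall fun x => ?_
    obtain ⟨i, hi⟩ := mem_iUnion.1 (hOc.ge (mem_univ x))
    exact mem_iUnion.2 ⟨(i, decide (f i x ∈ U i)), hi, by simp⟩
  obtain ⟨C, hCc, hC, hCV⟩ := exists_iUnion_eq_closed_subset hV (fun x => toFinite _) hVc
  refine ⟨fun i => C (i, true), fun i => C (i, false), fun i => hC _, fun i => hC _, ?_, ?_, ?_, ?_⟩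
  · intro i x hx
    obtain ⟨h1, h2⟩ := hCV _ hx
    have h3 := mem_iInter.1 (hfN i x h1) i
    rwa [if_pos (h2.2 rfl)] at h3
  · intro i
    refine disjoint_left.2 fun x hx => ?_
    obtain ⟨h1, h2⟩ := hCV _ hx
    have h3 := mem_iInter.1 (hfN i x h1) i
    rwa [if_neg (fun h => absurd (h2.1 h) (by simp))] at h3
  · intro i
    refine disjoint_left.2 fun x hx hx' => ?_
    exact absurd ((hCV _ hx').2.1 ((hCV _ hx).2.2 rfl)) (by simp)
  · intro x
    obtain ⟨⟨i, b⟩, hi⟩ := mem_iUnion.1 (hCc.ge (mem_univ x))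
    cases b
    exacts [⟨i, Or.inr hi⟩, ⟨i, Or.inl hi⟩]

/-- One step towards general position. The separators `A i` are absorbed into `F' i` and `D i` is
removed from `U' i`, so an open set whose closure stays in `U' i` and which contains `F' i` has
frontier missing both. Hence `n + 1` such frontiers indexed by `T` have no common point. -/
theorem HasCoveringDimLE.exists_pair_refinement {X ι : Type*} [TopologicalSpace X]
    [TopologicalSpace.MetrizableSpace X] {n : ℕ} (hX : HasCoveringDimLE X n)
    (F U : ι → Set X) (hF : ∀ i, IsClosed (F i)) (hU : ∀ i, IsOpen (U i))
    (hFU : ∀ i, F i ⊆ U i) (T : Finset ι) :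
    ∃ F' U' : ι → Set X, ((∀ i, IsClosed (F' i)) ∧ (∀ i, IsOpen (U' i)) ∧ ∀ i, F' i ⊆ U' i) ∧
      (∀ i, F i ⊆ interior (F' i)) ∧ (∀ i, closure (U' i) ⊆ U i) ∧
      (T.card = n + 1 → ∀ x, ∃ i ∈ T, x ∈ F' i ∨ x ∉ U' i) := by
  classical
  have h1 : ∃ A D : ι → Set X, (∀ i, IsClosed (A i)) ∧ (∀ i, IsClosed (D i)) ∧
      (∀ i, A i ⊆ U i) ∧ (∀ i, Disjoint (D i) (F i)) ∧ (∀ i, Disjoint (A i) (D i)) ∧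
      (T.card = n + 1 → ∀ x, ∃ i ∈ T, x ∈ A i ∨ x ∈ D i) := by
    by_cases hT : T.card = n + 1
    · let e := T.equivFinOfCardEq hT
      obtain ⟨A, D, hA, hD, hAU, hDF, hAD, hc⟩ := hX.exists_closed_separators
        (fun j => F (e.symm j)) (fun j => U (e.symm j)) (fun j => hF _) (fun j => hU _)
        (fun j => hFU _)
      refine ⟨fun i => if h : i ∈ T then A (e ⟨i, h⟩) else ∅,
        fun i => if h : i ∈ T then D (e ⟨i, h⟩) else ∅, ?_, ?_, ?_, ?_, ?_, ?_⟩
      · intro i; dsimp only; split_ifs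
        exacts [hA _, isClosed_empty]
      · intro i; dsimp only; split_ifs
        exacts [hD _, isClosed_empty]
      · intro i; dsimp only; split_ifs with h
        exacts [by simpa using hAU (e ⟨i, h⟩), empty_subset _]
      · intro i; dsimp only; split_ifs with h
        exacts [by simpa using hDF (e ⟨i, h⟩), empty_disjoint _]
      · intro i; dsimp only; split_ifs with h
        exacts [hAD _, empty_disjoint _]
      · intro _ x
        obtain ⟨j, hj⟩ := hc x
        exact ⟨e.symm j, (e.symm j).2, by simpa using hj⟩
    · exact ⟨fun _ => ∅, fun _ => ∅, by simp, by simp, by simp, by simp, by simp,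
        fun h => absurd h hT⟩
  obtain ⟨A, D, hA, hD, hAU, hDF, hAD, hc⟩ := h1
  have h2 : ∀ i, F i ∪ A i ⊆ U i \ D i := by
    rintro i x (hx | hx)
    · exact ⟨hFU i hx, fun h => disjoint_left.1 (hDF i) h hx⟩
    · exact ⟨hAU i hx, fun h => disjoint_left.1 (hAD i) hx h⟩
  have h3 : ∀ i, ∃ V, IsOpen V ∧ F i ∪ A i ⊆ V ∧ closure V ⊆ U i \ D i := fun i =>
    normal_exists_closure_subset ((hF i).union (hA i)) ((hU i).sdiff (hD i)) (h2 i)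
  choose V hV hFV hVU using h3
  have h4 : ∀ i, ∃ W, IsOpen W ∧ closure (V i) ⊆ W ∧ closure W ⊆ U i \ D i := fun i =>
    normal_exists_closure_subset isClosed_closure ((hU i).sdiff (hD i)) (hVU i)
  choose W hW hVW hWU using h4
  refine ⟨fun i => closure (V i), W, ⟨fun i => isClosed_closure, hW, hVW⟩, ?_, ?_, ?_⟩
  · exact fun i => (subset_union_left.trans (hFV i)).trans (hV i).subset_interior_closure
  · exact fun i => (hWU i).trans sdiff_subset
  · intro hT x
    obtain ⟨i, hi, h | h⟩ := hc hT x
    · exact ⟨i, hi, Or.inl (subset_closure (hFV i (Or.inr h)))⟩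
    · exact ⟨i, hi, Or.inr fun h' => (hWU i (subset_closure h')).2 h⟩

/-- In a space of covering dimension at most `n`, countably many open sets can be perturbed so that
no point lies on the frontiers of `n + 1` of them. -/
theorem HasCoveringDimLE.exists_general_position {X ι : Type*} [TopologicalSpace X]
    [TopologicalSpace.MetrizableSpace X] [Countable ι] {n : ℕ} (hX : HasCoveringDimLE X n)
    (F U : ι → Set X) (hF : ∀ i, IsClosed (F i)) (hU : ∀ i, IsOpen (U i))
    (hFU : ∀ i, F i ⊆ U i) :
    ∃ O : ι → Set X, (∀ i, IsOpen (O i)) ∧ (∀ i, F i ⊆ O i) ∧ (∀ i, O i ⊆ U i) ∧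
      ∀ T : Finset ι, T.card = n + 1 → ∀ x, ∃ i ∈ T, x ∉ frontier (O i) := by
  classical
  let S := {q : (ι → Set X) × (ι → Set X) //
    (∀ i, IsClosed (q.1 i)) ∧ (∀ i, IsOpen (q.2 i)) ∧ ∀ i, q.1 i ⊆ q.2 i}
  have step : ∀ (q : S) (T : Finset ι), ∃ q' : S,
      (∀ i, q.1.1 i ⊆ interior (q'.1.1 i)) ∧ (∀ i, closure (q'.1.2 i) ⊆ q.1.2 i) ∧
      (T.card = n + 1 → ∀ x, ∃ i ∈ T, x ∈ q'.1.1 i ∨ x ∉ q'.1.2 i) := by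
    rintro ⟨⟨F, U⟩, hF, hU, hFU⟩ T
    obtain ⟨F', U', h, h'⟩ := hX.exists_pair_refinement F U hF hU hFU T
    exact ⟨⟨⟨F', U'⟩, h⟩, h'⟩
  choose next h1 h2 h3 using step
  obtain ⟨T, hT⟩ := exists_surjective_nat (Finset ι)
  let q : ℕ → S := fun k => Nat.rec ⟨⟨F, U⟩, hF, hU, hFU⟩ (fun k s => next s (T k)) k
  have hq : ∀ k, q (k + 1) = next (q k) (T k) := fun k => rfl
  have hF1 : ∀ k i, (q k).1.1 i ⊆ interior ((q (k + 1)).1.1 i) := fun k i => h1 (q k) (T k) i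
  have hU1 : ∀ k i, closure ((q (k + 1)).1.2 i) ⊆ (q k).1.2 i := fun k i => h2 (q k) (T k) i
  have hFm : ∀ i, Monotone fun k => (q k).1.1 i := fun i =>
    monotone_nat_of_le_succ fun k => (hF1 k i).trans interior_subset
  have hUm : ∀ i, Antitone fun k => (q k).1.2 i := fun i =>
    antitone_nat_of_succ_le fun k => subset_closure.trans (hU1 k i)
  have hFU' : ∀ i k l, (q k).1.1 i ⊆ (q l).1.2 i := fun i k l =>
    ((hFm i (le_max_left k l)).trans ((q (max k l)).2.2.2 i)).trans (hUm i (le_max_right k l))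
  -- The limit set is squeezed between all the nested pairs, so its frontier avoids every inner set
  -- and lies in every outer set; each finite `T` was treated at some stage.
  let O : ι → Set X := fun i => ⋃ k, interior ((q k).1.1 i)
  have hFO : ∀ i k, (q k).1.1 i ⊆ O i := fun i k =>
    (hF1 k i).trans (subset_iUnion (fun k => interior ((q k).1.1 i)) (k + 1))
  have hOU : ∀ i k, O i ⊆ (q k).1.2 i := fun i k =>
    iUnion_subset fun l => interior_subset.trans (hFU' i l k)
  have hOo : ∀ i, IsOpen (O i) := fun i => isOpen_iUnion fun k => isOpen_interior
  refine ⟨O, hOo, fun i => hFO i 0, fun i => hOU i 0, fun T' hT' x => ?_⟩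
  obtain ⟨k, rfl⟩ := hT T'
  obtain ⟨i, hi, h⟩ := h3 (q k) (T k) hT' x
  refine ⟨i, hi, fun hx => ?_⟩
  rw [(hOo i).frontier_eq] at hx
  rw [← hq] at h
  rcases h with h | h
  · exact hx.2 (hFO i (k + 1) h)
  · exact h (hU1 (k + 1) i (closure_mono (hOU i (k + 2)) hx.1))

/-! ### Zero-dimensional subspaces and the countable sum theorem -/

/-- The topology of the subspace `Z` is generated by the fibres of countably many locally constant
functions. For metrizable `Z` this says that `Z` has covering dimension at most zero. -/
def ZeroDimOn {Y : Type*} [TopologicalSpace Y] (Z : Set Y) : Prop :=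
  ∃ f : ℕ → Y → Y, (∀ m, LocConstOn (f m) Z) ∧
    ∀ x ∈ Z, ∀ V ∈ 𝓝 x, ∃ m, ∀ y ∈ Z, f m y = f m x → y ∈ V

theorem ZeroDimOn.of_countable {Y α ι : Type*} [TopologicalSpace Y] [Countable ι] {Z : Set Y}
    (f : ι → Y → α) (hf : ∀ m, LocConstOn (f m) Z)
    (h : ∀ x ∈ Z, ∀ V ∈ 𝓝 x, ∃ m, ∀ y ∈ Z, f m y = f m x → y ∈ V) : ZeroDimOn Z := by
  classical
  rcases isEmpty_or_nonempty ι with hι | hι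
  · exact ⟨fun _ => id, fun m x hx => (hι.false (h x hx univ univ_mem).choose).elim,
      fun x hx => (hι.false (h x hx univ univ_mem).choose).elim⟩
  rcases isEmpty_or_nonempty Y with hY | hY
  · exact ⟨fun _ => id, fun m x => isEmptyElim x, fun x => isEmptyElim x⟩
  obtain ⟨e, he⟩ := exists_surjective_nat ι
  -- Values of an arbitrary type are encoded in `Y` by choosing one point in each level set.
  refine ⟨fun m y => Function.invFun (f (e m)) (f (e m) y), fun m => (hf _).comp_left _,
    fun x hx V hV => ?_⟩
  obtain ⟨i, hi⟩ := h x hx V hV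
  obtain ⟨m, rfl⟩ := he i
  refine ⟨m, fun y hy hyx => hi y hy ?_⟩
  have h1 : ∀ z, f (e m) (Function.invFun (f (e m)) (f (e m) z)) = f (e m) z :=
    fun z => Function.invFun_eq ⟨z, rfl⟩
  rw [← h1 y, ← h1 x]
  exact congrArg (f (e m)) hyx

theorem ZeroDimOn.comap {Y Y' : Type*} [TopologicalSpace Y] [TopologicalSpace Y'] {Z : Set Y}
    {Z' : Set Y'} (h : ZeroDimOn Z) (Φ : Y' → Y) (hm : MapsTo Φ Z' Z) (hc : ContinuousOn Φ Z')
    (hi : ∀ x ∈ Z', ∀ V ∈ 𝓝 x, ∃ W ∈ 𝓝 (Φ x), ∀ y ∈ Z', Φ y ∈ W → y ∈ V) : ZeroDimOn Z' := by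
  obtain ⟨f, hf, hb⟩ := h
  refine ZeroDimOn.of_countable (fun m y => f m (Φ y)) (fun m x hx => ?_) (fun x hx V hV => ?_)
  · exact ((hc x hx).tendsto_nhdsWithin hm).eventually (hf m (Φ x) (hm hx))
  · obtain ⟨W, hW, hWV⟩ := hi x hx V hV
    obtain ⟨m, hm'⟩ := hb (Φ x) (hm hx) W hW
    exact ⟨m, fun y hy hyx => hWV y hy (hm' (Φ y) (hm hy) hyx)⟩

theorem ZeroDimOn.mono {Y : Type*} [TopologicalSpace Y] {Z W : Set Y} (h : ZeroDimOn Z)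
    (hW : W ⊆ Z) : ZeroDimOn W :=
  h.comap id hW continuousOn_id fun _ _ V hV => ⟨V, hV, fun _ _ h => h⟩

theorem ZeroDimOn.prod {Y Y' : Type*} [TopologicalSpace Y] [TopologicalSpace Y'] {Z : Set Y}
    {Z' : Set Y'} (h : ZeroDimOn Z) (h' : ZeroDimOn Z') : ZeroDimOn (Z ×ˢ Z') := by
  obtain ⟨f, hf, hb⟩ := h
  obtain ⟨f', hf', hb'⟩ := h'
  refine ZeroDimOn.of_countable (ι := ℕ × ℕ) (fun m y => (f m.1 y.1, f' m.2 y.2)) ?_ ?_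
  · rintro m ⟨x, x'⟩ ⟨hx, hx'⟩
    rw [nhdsWithin_prod_eq]
    filter_upwards [(hf m.1 x hx).prod_mk (hf' m.2 x' hx')] with y hy
    exact Prod.ext hy.1 hy.2
  · rintro ⟨x, x'⟩ ⟨hx, hx'⟩ V hV
    obtain ⟨W, hW, W', hW', hV'⟩ := mem_nhds_prod_iff.1 hV
    obtain ⟨m, hm⟩ := hb x hx W hW
    obtain ⟨m', hm'⟩ := hb' x' hx' W' hW'
    refine ⟨(m, m'), fun y hy hyx => hV' ⟨hm _ hy.1 ?_, hm' _ hy.2 ?_⟩⟩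
    exacts [congrArg Prod.fst hyx, congrArg Prod.snd hyx]

/-- The joint level sets of `f 0, …, f m` form successively finer partitions of `Z`. Each point is
assigned the first stage at which its level set fits inside some `N z`; stage and choice of `z`
depend only on that level set. -/
theorem ZeroDimOn.exists_refinement {Y : Type*} [TopologicalSpace Y] {Z : Set Y}
    (h : ZeroDimOn Z) (N : Y → Set Y) (hN : ∀ z ∈ Z, N z ∈ 𝓝 z) :
    ∃ f : Y → Y, LocConstOn f Z ∧ (∀ x ∈ Z, f x ∈ Z) ∧ ∀ x ∈ Z, x ∈ N (f x) := by
  classical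
  obtain ⟨f, hf, hb⟩ := h
  let P : ℕ → Y → Y → Prop := fun m x z => z ∈ Z ∧ ∀ y ∈ Z, (∀ j ≤ m, f j y = f j x) → y ∈ N z
  have hP : ∀ x ∈ Z, ∃ m, ∃ z, P m x z := by
    intro x hx
    obtain ⟨m, hm⟩ := hb x hx (N x) (hN x hx)
    exact ⟨m, x, hx, fun y hy h => hm y hy (h m le_rfl)⟩
  have hcong : ∀ m x x', (∀ j ≤ m, f j x = f j x') → P m x = P m x' := by
    intro m x x' h
    funext z
    exact propext (and_congr_right fun _ => forall₂_congr fun y _ =>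
      imp_congr_left (forall₂_congr fun j hj => by rw [h j hj]))
  let k : Y → ℕ := fun x => if h : ∃ m, ∃ z, P m x z then Nat.find h else 0
  -- The nonemptiness witness is a proof, so equal predicates give the same chosen point.
  let g : Y → Y := fun x => @Classical.epsilon _ ⟨x⟩ (P (k x) x)
  have hk : ∀ x ∈ Z, ∃ z, P (k x) x z := by
    intro x hx
    simp only [k, dif_pos (hP x hx)]
    exact Nat.find_spec (hP x hx)
  have hkmin : ∀ x ∈ Z, ∀ m, (∃ z, P m x z) → k x ≤ m := by
    intro x hx m h
    simp only [k, dif_pos (hP x hx)]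
    exact Nat.find_min' _ h
  have hg : ∀ x ∈ Z, P (k x) x (g x) := fun x hx => Classical.epsilon_spec (hk x hx)
  refine ⟨g, ?_, fun x hx => (hg x hx).1, fun x hx => (hg x hx).2 x hx fun _ _ => rfl⟩
  intro x hx
  have h1 : ∀ᶠ y in 𝓝[Z] x, ∀ j ∈ Finset.range (k x + 1), f j y = f j x := by
    rw [Filter.eventually_all_finset]
    exact fun j _ => hf j x hx
  filter_upwards [h1, self_mem_nhdsWithin] with y hy hyZ
  have hy' : ∀ j ≤ k x, f j y = f j x := fun j hj => hy j (by simpa [Nat.lt_succ_iff] using hj)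
  have hkle : k y ≤ k x := hkmin y hyZ _ (by rw [hcong _ _ _ hy']; exact hk x hx)
  have hkle' : k x ≤ k y := hkmin x hx _ (by
    rw [← hcong _ _ _ fun j hj => hy' j (hj.trans hkle)]; exact hk y hyZ)
  have hkeq : k y = k x := le_antisymm hkle hkle'
  simp only [g]
  rw [hkeq, hcong _ _ _ hy']

/-- Apply the hypothesis to balls of radius `1 / (m + 1)`: points of `Z` with the same value lie in
one small ball. -/
theorem ZeroDimOn.of_refinement {Y : Type*} [TopologicalSpace Y]
    [TopologicalSpace.MetrizableSpace Y] {Z : Set Y}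
    (h : ∀ N : Y → Set Y, (∀ z, IsOpen (N z)) → (∀ z, z ∈ N z) →
      ∃ f : Y → Y, LocConstOn f Z ∧ ∀ x ∈ Z, x ∈ N (f x)) : ZeroDimOn Z := by
  let _ := TopologicalSpace.metrizableSpaceMetric Y
  have h1 : ∀ m : ℕ, ∃ f : Y → Y, LocConstOn f Z ∧ ∀ x ∈ Z, x ∈ Metric.ball (f x) (1 / (m + 1)) :=
    fun m => h _ (fun z => Metric.isOpen_ball) fun z => Metric.mem_ball_self (by positivity)
  choose f hf hfb using h1
  refine ⟨f, hf, fun x hx V hV => ?_⟩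
  obtain ⟨ε, hε, hV'⟩ := Metric.mem_nhds_iff.1 hV
  obtain ⟨m, hm⟩ := exists_nat_one_div_lt (half_pos hε)
  refine ⟨m, fun y hy hyx => hV' ?_⟩
  have h2 := hfb m y hy
  have h3 := hfb m x hx
  rw [hyx] at h2
  rw [Metric.mem_ball] at *
  linarith [dist_triangle_right y x (f m x)]

/-- The inductive step of the sum theorem: a subordinate selection on `C` is prolonged over `F` and
then over a closed neighbourhood of `C ∪ F`. -/
theorem ZeroDimOn.exists_locConstOn_enlargement {Y : Type*} [TopologicalSpace Y]
    [TopologicalSpace.MetrizableSpace Y] {F : Set Y} (hF : ZeroDimOn F) (hFc : IsClosed F)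
    (N : Y → Set Y) (hN : ∀ z, IsOpen (N z)) (hzN : ∀ z, z ∈ N z) {C : Set Y} (hC : IsClosed C)
    {f : Y → Y} (hf : LocConstOn f C) (hfN : ∀ x ∈ C, x ∈ N (f x)) :
    ∃ (C' : Set Y) (f' : Y → Y), IsClosed C' ∧ LocConstOn f' C' ∧ (∀ x ∈ C', x ∈ N (f' x)) ∧
      F ⊆ C' ∧ C ⊆ interior C' ∧ EqOn f' f C := by
  classical
  obtain ⟨h, hh, -, hhM⟩ := hF.exists_refinement
    -- The cover is cut down so that a piece centred in `C` meets `C` only where `f` has the value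
    -- at the centre, and a piece centred off `C` misses `C`. The new selection on `F` therefore
    -- agrees with `f` on `C ∩ F`.
    (fun z => if z ∈ C then N (f z) ∩ {y | y ∈ C → f y = f z} else N z ∩ Cᶜ) (by
      intro z _
      split_ifs with hz
      · exact inter_mem ((hN _).mem_nhds (hfN z hz)) (mem_nhdsWithin_iff_eventually.1 (hf z hz))
      · exact inter_mem ((hN _).mem_nhds (hzN z)) (hC.isOpen_compl.mem_nhds hz))
  let i : Y → Y := fun z => if z ∈ C then f z else z
  let g : Y → Y := fun y => if y ∈ C then f y else i (h y)
  have hgC : EqOn g f C := fun y hy => if_pos hy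
  have hgF : ∀ y ∈ F, g y = i (h y) ∧ y ∈ N (i (h y)) := by
    intro y hy
    have h1 := hhM y hy
    by_cases hyC : h y ∈ C
    · simp only [if_pos hyC] at h1
      simp only [i, if_pos hyC]
      refine ⟨?_, h1.1⟩
      by_cases hy' : y ∈ C
      · rw [hgC hy']; exact h1.2 hy'
      · simp only [g, i, if_neg hy', if_pos hyC]
    · simp only [if_neg hyC] at h1
      simp only [i, if_neg hyC]
      exact ⟨by simp only [g, i, if_neg h1.2, if_neg hyC], h1.1⟩
  have hgl : LocConstOn g (C ∪ F) := by
    refine LocConstOn.union hC hFc (fun x hx => ?_) (fun x hx => ?_)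
    · filter_upwards [hf x hx, self_mem_nhdsWithin] with y hy hyC
      rw [hgC hyC, hgC hx, hy]
    · filter_upwards [hh x hx, self_mem_nhdsWithin] with y hy hyF
      rw [(hgF y hyF).1, (hgF x hx).1, hy]
  have hgN : ∀ x ∈ C ∪ F, x ∈ N (g x) := by
    rintro x (hx | hx)
    · rw [hgC hx]; exact hfN x hx
    · rw [(hgF x hx).1]; exact (hgF x hx).2
  obtain ⟨O, f', hO, hCO, hf', hf'g⟩ := hgl.extend
  obtain ⟨V, hV, hCV, hVO⟩ := normal_exists_closure_subset (hC.union hFc) (hf'.isOpen hO hN)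
    fun x hx => ⟨hCO hx, by rw [hf'g hx]; exact hgN x hx⟩
  refine ⟨closure V, f', isClosed_closure, hf'.mono fun x hx => (hVO hx).1,
    fun x hx => (hVO hx).2, ?_, ?_, fun x hx => ?_⟩
  · exact (subset_union_right.trans hCV).trans subset_closure
  · exact (subset_union_left.trans hCV).trans hV.subset_interior_closure
  · rw [hf'g (Or.inl hx), hgC hx]

/-- Selections are prolonged over one `F k` at a time. Each domain lies in the interior of the next,
so near any point the limit coincides with a single stage and is locally constant. -/
theorem ZeroDimOn.univ_of_iUnion_isClosed {Y : Type*} [TopologicalSpace Y]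
    [TopologicalSpace.MetrizableSpace Y] (F : ℕ → Set Y) (hF : ∀ k, IsClosed (F k))
    (hFu : ⋃ k, F k = univ) (hFz : ∀ k, ZeroDimOn (F k)) : ZeroDimOn (univ : Set Y) := by
  classical
  refine ZeroDimOn.of_refinement fun N hN hzN => ?_
  let S := {q : Set Y × (Y → Y) // IsClosed q.1 ∧ LocConstOn q.2 q.1 ∧ ∀ x ∈ q.1, x ∈ N (q.2 x)}
  have step : ∀ (q : S) (k : ℕ), ∃ q' : S, F k ⊆ q'.1.1 ∧ q.1.1 ⊆ interior q'.1.1 ∧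
      EqOn q'.1.2 q.1.2 q.1.1 := by
    rintro ⟨⟨C, f⟩, hC, hf, hfN⟩ k
    obtain ⟨C', f', h1, h2, h3, h4⟩ :=
      (hFz k).exists_locConstOn_enlargement (hF k) N hN hzN hC hf hfN
    exact ⟨⟨⟨C', f'⟩, h1, h2, h3⟩, h4⟩
  choose next h1 h2 h3 using step
  let q : ℕ → S := fun k => Nat.rec
    ⟨⟨∅, id⟩, isClosed_empty, fun x hx => hx.elim, fun x hx => hx.elim⟩ (fun k s => next s k) k
  have hF1 : ∀ k, F k ⊆ (q (k + 1)).1.1 := fun k => h1 (q k) k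
  have hI : ∀ k, (q k).1.1 ⊆ interior (q (k + 1)).1.1 := fun k => h2 (q k) k
  have hE : ∀ k, EqOn (q (k + 1)).1.2 (q k).1.2 (q k).1.1 := fun k => h3 (q k) k
  have hm : Monotone fun k => (q k).1.1 :=
    monotone_nat_of_le_succ fun k => (hI k).trans interior_subset
  have hE' : ∀ k l, k ≤ l → EqOn (q l).1.2 (q k).1.2 (q k).1.1 := by
    intro k l hkl
    induction l, hkl using Nat.le_induction with
    | base => exact fun _ _ => rfl
    | succ l hkl ih => exact fun x hx => (hE l (hm hkl hx)).trans (ih hx)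
  have hex : ∀ x, ∃ k, x ∈ (q k).1.1 := fun x => by
    obtain ⟨k, hk⟩ := mem_iUnion.1 (hFu.ge (mem_univ x))
    exact ⟨k + 1, hF1 k hk⟩
  choose k hk using hex
  let g : Y → Y := fun x => (q (k x)).1.2 x
  have hg : ∀ l, ∀ x ∈ (q l).1.1, g x = (q l).1.2 x := by
    intro l x hx
    rcases le_total (k x) l with h | h
    · exact (hE' _ _ h (hk x)).symm
    · exact hE' _ _ h hx
  refine ⟨g, fun x _ => ?_, fun x _ => (q (k x)).2.2.2 x (hk x)⟩
  have hx := hI _ (hk x)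
  have hn := mem_interior_iff_mem_nhds.1 hx
  have h4 := (q (k x + 1)).2.2.1 x (interior_subset hx)
  rw [nhdsWithin_eq_nhds.2 hn] at h4
  rw [nhdsWithin_univ]
  filter_upwards [h4, hn] with y hy hyq
  rw [hg (k x + 1) y hyq, hg (k x + 1) x (interior_subset hx), hy]

theorem exists_isClosed_of_isGδ_compl {Y : Type*} [TopologicalSpace Y] {S : Set Y}
    (h : IsGδ Sᶜ) : ∃ C : ℕ → Set Y, (∀ m, IsClosed (C m)) ∧ S = ⋃ m, C m := by
  obtain ⟨O, hO, h⟩ := isGδ_iff_eq_iInter_nat.1 h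
  refine ⟨fun m => (O m)ᶜ, fun m => (hO m).isClosed_compl, ?_⟩
  rw [← compl_iInter, ← h, compl_compl]

/-- The countable sum theorem in dimension zero, for sets that are countable unions of closed
sets. -/
theorem ZeroDimOn.of_countable_cover {Y ι : Type*} [TopologicalSpace Y]
    [TopologicalSpace.MetrizableSpace Y] [Countable ι] {Z : Set Y} (S : ι → Set Y)
    (hS : ∀ i, IsGδ (S i)ᶜ) (hZ : Z ⊆ ⋃ i, S i) (hz : ∀ i, ZeroDimOn (Z ∩ S i)) :
    ZeroDimOn Z := by
  choose C hC hSC using fun i => exists_isClosed_of_isGδ_compl (hS i)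
  rcases isEmpty_or_nonempty ι with hι | hι
  · rw [iUnion_of_empty, subset_empty_iff] at hZ
    subst hZ
    exact ⟨fun _ => id, fun m x hx => hx.elim, fun x hx => hx.elim⟩
  obtain ⟨e, he⟩ := exists_surjective_nat (ι × ℕ)
  have h1 : ZeroDimOn (univ : Set Z) := by
    refine ZeroDimOn.univ_of_iUnion_isClosed
      (fun k => (Subtype.val ⁻¹' C (e k).1 (e k).2 : Set Z))
      (fun k => (hC _ _).preimage continuous_subtype_val) ?_ fun k => ?_
    · refine eq_univ_of_forall fun x => ?_
      obtain ⟨i, hi⟩ := mem_iUnion.1 (hZ x.2)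
      rw [hSC] at hi
      obtain ⟨m, hm⟩ := mem_iUnion.1 hi
      obtain ⟨k, hk⟩ := he (i, m)
      exact mem_iUnion.2 ⟨k, by rw [hk]; exact hm⟩
    · refine (hz (e k).1).comap Subtype.val (fun x hx => ⟨x.2, ?_⟩)
        continuous_subtype_val.continuousOn fun x _ V hV => ?_
      · rw [hSC]; exact mem_iUnion.2 ⟨_, hx⟩
      · obtain ⟨W, hW, h⟩ := mem_nhds_subtype _ _ _ |>.1 hV
        exact ⟨W, hW, fun y _ hy => h hy⟩
  obtain ⟨f, hf, hb⟩ := h1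
  classical
  let r : Y → Option Z := fun y => if h : y ∈ Z then some ⟨y, h⟩ else none
  refine ZeroDimOn.of_countable (fun m y => (r y).map (f m)) (fun m x hx => ?_)
    fun x hx V hV => ?_
  · have h2 := hf m ⟨x, hx⟩ (mem_univ _)
    rw [nhdsWithin_univ, nhds_subtype_eq_comap, eventually_comap] at h2
    rw [eventually_nhdsWithin_iff]
    filter_upwards [h2] with y hy hyZ
    simp only [r, dif_pos hyZ, dif_pos hx, Option.map_some]
    rw [hy ⟨y, hyZ⟩ rfl]
  · obtain ⟨m, hm⟩ := hb ⟨x, hx⟩ (mem_univ _) (Subtype.val ⁻¹' V)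
      (continuous_subtype_val.continuousAt.preimage_mem_nhds hV)
    refine ⟨m, fun y hy hyx => hm ⟨y, hy⟩ (mem_univ _) ?_⟩
    simpa [r, hy, hx] using hyx

/-! ### Dimension ranks -/

/-- A function whose level sets are zero-dimensional and whose superlevel sets are countable unions
of closed sets. -/
structure IsDimRank {Y : Type*} [TopologicalSpace Y] (r : Y → ℕ) : Prop where
  isGδ : ∀ i, IsGδ {y | i ≤ r y}ᶜ
  zeroDimOn : ∀ i, ZeroDimOn {y | r y = i}

/-- The rank counts the sets `O m` having the point on their frontier; general position bounds it by
`n`. On a level of rank `i`, prescribing `i` of these frontiers determines them all, so every `O m`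
becomes relatively clopen, and these sets with their colourings separate points from closed sets. -/
theorem HasCoveringDimLE.exists_isDimRank {X : Type*} [TopologicalSpace X]
    [TopologicalSpace.MetrizableSpace X] {n : ℕ} (hX : HasCoveringDimLE X n) :
    ∃ r : X → ℕ, IsDimRank r ∧ ∀ x, r x ≤ n := by
  classical
  let _ := TopologicalSpace.metrizableSpaceMetric X
  choose U f hU hUc hf hfb using fun k : ℕ => hX.exists_coloring
    (fun x => Metric.ball x (1 / ((k : ℝ) + 1))) (fun x => Metric.isOpen_ball)
    (fun x => Metric.mem_ball_self (by positivity))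
  choose F hFc hF hFU using fun k : ℕ =>
    exists_iUnion_eq_closed_subset (hU k) (fun x => toFinite _) (hUc k)
  obtain ⟨O, hO, hFO, hOU, hT⟩ := hX.exists_general_position
    (fun m : ℕ × Fin (n + 1) => F m.1 m.2) (fun m => U m.1 m.2) (fun m => hF _ _)
    (fun m => hU _ _) (fun m => hFU _ _)
  let D : X → Set (ℕ × Fin (n + 1)) := fun x => {m | x ∈ frontier (O m)}
  have hDn : ∀ x, (D x).encard ≤ n := by
    intro x
    by_contra h
    have h1 : ((n + 1 : ℕ) : ℕ∞) ≤ (D x).encard := by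
      push_cast
      exact Order.add_one_le_of_lt (not_le.1 h)
    obtain ⟨T, hTD, hTc⟩ := exists_subset_encard_eq h1
    have hfin : T.Finite := finite_of_encard_eq_coe hTc
    rw [hfin.encard_eq_coe_toFinset_card] at hTc
    obtain ⟨m, hm, hmx⟩ := hT hfin.toFinset (by exact_mod_cast hTc) x
    exact hmx (hTD (hfin.mem_toFinset.1 hm))
  have hDf : ∀ x, (D x).Finite := fun x => finite_of_encard_le_coe (hDn x)
  let S : Finset (ℕ × Fin (n + 1)) → Set X := fun T => {x | ∀ m ∈ T, x ∈ frontier (O m)}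
  have hS : ∀ T, IsClosed (S T) := by
    intro T
    have : S T = ⋂ m ∈ T, frontier (O m) := by ext x; simp [S]
    rw [this]
    exact isClosed_biInter fun m _ => isClosed_frontier
  have hle : ∀ i, {x | i ≤ (D x).ncard} =
      ⋃ T : {T : Finset (ℕ × Fin (n + 1)) // T.card = i}, S T := by
    intro i
    ext x
    simp only [mem_ofPred_eq, mem_iUnion]
    constructor
    · intro h
      rw [ncard_eq_toFinset_card _ (hDf x)] at h
      obtain ⟨T, hTD, hTc⟩ := Finset.exists_subset_card_eq h
      exact ⟨⟨T, hTc⟩, fun m hm => (hDf x).mem_toFinset.1 (hTD hm)⟩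
    · rintro ⟨⟨T, rfl⟩, hT⟩
      rw [← ncard_coe_finset]
      exact ncard_le_ncard (fun m hm => hT m hm) (hDf x)
  refine ⟨fun x => (D x).ncard, ⟨fun i => ?_, fun i => ?_⟩, fun x => ?_⟩
  · rw [hle, compl_iUnion]
    exact IsGδ.iInter_of_isOpen fun T => (hS T).isOpen_compl
  · refine ZeroDimOn.of_countable_cover
      (fun T : {T : Finset (ℕ × Fin (n + 1)) // T.card = i} => S T)
      (fun T => (hS T).isOpen_compl.isGδ) ?_ ?_
    · rw [← hle]
      exact fun x hx => (show (D x).ncard = i from hx).ge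
    · rintro ⟨T, rfl⟩
      have hDT : ∀ x ∈ {x | (D x).ncard = T.card} ∩ S T, D x = T := by
        rintro x ⟨hx, hxT⟩
        refine (eq_of_subset_of_ncard_le (fun m hm => hxT m hm) ?_ (hDf x)).symm
        rw [ncard_coe_finset]
        exact (show (D x).ncard = T.card from hx).le
      refine ZeroDimOn.of_countable (ι := ℕ × Fin (n + 1))
        (fun m y => if y ∈ O m then some (f m.1 m.2 y) else none) (fun m x hx => ?_)
        fun x hx V hV => ?_
      · by_cases hm : m ∈ T
        -- For `m ∈ T` the piece lies in the frontier of the open set `O m`, hence is disjoint from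
        -- it.
        · have hno : ∀ y ∈ {x | (D x).ncard = T.card} ∩ S T, y ∉ O m := by
            intro y hy hyO
            have h2 : y ∈ frontier (O m) := hy.2 m hm
            rw [(hO m).frontier_eq] at h2
            exact h2.2 hyO
          filter_upwards [self_mem_nhdsWithin] with y hy
          rw [if_neg (hno y hy), if_neg (hno x hx)]
        · refine Filter.Eventually.filter_mono nhdsWithin_le_nhds ?_
          have hxf : x ∉ frontier (O m) := fun h => hm (by
            have h3 : m ∈ D x := h
            rw [hDT x hx] at h3
            exact h3)
          by_cases hxO : x ∈ O m
          · have h4 := hf m.1 m.2 x (hOU m hxO)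
            rw [(hU _ _).nhdsWithin_eq (hOU m hxO)] at h4
            filter_upwards [h4, (hO m).mem_nhds hxO] with y hy hyO
            rw [if_pos hyO, if_pos hxO, hy]
          · rw [(hO m).frontier_eq] at hxf
            have hxc : x ∉ closure (O m) := fun h => hxf ⟨h, hxO⟩
            filter_upwards [isClosed_closure.isOpen_compl.mem_nhds hxc] with y hy
            rw [if_neg fun h => hy (subset_closure h), if_neg hxO]
      · obtain ⟨ε, hε, hV'⟩ := Metric.mem_nhds_iff.1 hV
        obtain ⟨k, hk⟩ := exists_nat_one_div_lt (half_pos hε)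
        obtain ⟨j, hj⟩ := mem_iUnion.1 ((hFc k).ge (mem_univ x))
        have hxO : x ∈ O (k, j) := hFO (k, j) hj
        refine ⟨(k, j), fun y _ hyx => hV' ?_⟩
        simp only [if_pos hxO] at hyx
        split_ifs at hyx with hyO
        have h1 := hfb k j y (hOU (k, j) hyO)
        have h2 := hfb k j x (hOU (k, j) hxO)
        rw [Option.some.inj hyx] at h1
        rw [Metric.mem_ball] at *
        linarith [dist_triangle_right y x (f k j x)]
  · have h := hDn x
    rw [← (hDf x).cast_ncard_eq] at h
    exact_mod_cast h

/-- On the level where the sum is `k`, the conditions `i ≤ r` and `k - i ≤ s` force equality. Thus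
finitely many F_σ sets cut this level into products of levels, and the sum theorem applies. -/
theorem IsDimRank.prod {Y Y' : Type*} [TopologicalSpace Y] [TopologicalSpace Y']
    [TopologicalSpace.MetrizableSpace Y] [TopologicalSpace.MetrizableSpace Y'] {r : Y → ℕ}
    {s : Y' → ℕ} (hr : IsDimRank r) (hs : IsDimRank s) :
    IsDimRank fun z : Y × Y' => r z.1 + s z.2 := by
  have hG : ∀ i j, IsGδ {z : Y × Y' | i ≤ r z.1 ∧ j ≤ s z.2}ᶜ := by
    intro i j
    have : {z : Y × Y' | i ≤ r z.1 ∧ j ≤ s z.2}ᶜ =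
        Prod.fst ⁻¹' {y | i ≤ r y}ᶜ ∪ Prod.snd ⁻¹' {y | j ≤ s y}ᶜ := by
      rw [preimage_compl, preimage_compl, ← compl_inter]
      rfl
    rw [this]
    exact ((hr.isGδ i).preimage continuous_fst).union ((hs.isGδ j).preimage continuous_snd)
  have hle : ∀ k, {z : Y × Y' | k ≤ r z.1 + s z.2} =
      ⋃ i : Fin (k + 1), {z : Y × Y' | (i : ℕ) ≤ r z.1 ∧ k - i ≤ s z.2} := by
    intro k
    ext z
    simp only [mem_ofPred_eq, mem_iUnion]
    constructor
    · intro h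
      exact ⟨⟨min k (r z.1), by omega⟩, by simp, by simp; omega⟩
    · rintro ⟨i, h1, h2⟩
      omega
  refine ⟨fun k => ?_, fun k => ?_⟩
  · rw [hle, compl_iUnion]
    exact IsGδ.iInter fun i => hG _ _
  · refine ZeroDimOn.of_countable_cover
      (fun i : Fin (k + 1) => {z : Y × Y' | (i : ℕ) ≤ r z.1 ∧ k - i ≤ s z.2})
      (fun i => hG _ _) ?_ fun i => ?_
    · rw [← hle]
      exact fun z hz => (show r z.1 + s z.2 = k from hz).ge
    · refine ((hr.zeroDimOn i).prod (hs.zeroDimOn (k - i))).mono ?_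
      rintro z ⟨hz, h1, h2⟩
      have hz' : r z.1 + s z.2 = k := hz
      have := i.2
      exact ⟨show r z.1 = i by omega, show s z.2 = k - i by omega⟩

/-! ### Local sections of the endpoint map -/

theorem SemilocallyContractible.exists_local_paths {X : Type*} [TopologicalSpace X]
    [PathConnectedSpace X] (hX : SemilocallyContractible X) (x x' : X) :
    ∃ V ∈ 𝓝 x, ∃ V' ∈ 𝓝 x', ∃ γ : (V × V') × I → X, Continuous γ ∧
      (∀ w, γ (w, 0) = w.1) ∧ ∀ w, γ (w, 1) = w.2 := by
  obtain ⟨V, hV, a, ⟨H⟩⟩ := hX x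
  obtain ⟨V', hV', a', ⟨H'⟩⟩ := hX x'
  let α : ∀ w : V × V', Path (w.1 : X) a := fun w =>
    { toFun := fun t => H (t, w.1)
      continuous_toFun := by fun_prop
      source' := by simp
      target' := by simp }
  let β : ∀ w : V × V', Path (w.2 : X) a' := fun w =>
    { toFun := fun t => H' (t, w.2)
      continuous_toFun := by fun_prop
      source' := by simp
      target' := by simp }
  have hα : Continuous ↿α :=
    H.continuous.comp (continuous_snd.prodMk (continuous_fst.comp continuous_fst))
  have hβ : Continuous ↿β :=
    H'.continuous.comp (continuous_snd.prodMk (continuous_snd.comp continuous_fst))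
  let δ : ∀ _ : V × V', Path a a' := fun _ => PathConnectedSpace.somePath a a'
  have hδ : Continuous ↿δ := (PathConnectedSpace.somePath a a').continuous.comp continuous_snd
  refine ⟨V, hV, V', hV', fun q => (((α q.1).trans (δ q.1)).trans (β q.1).symm) q.2,
    Path.trans_continuous_family _ (Path.trans_continuous_family α hα δ hδ) _
      (Path.symm_continuous_family β hβ), fun w => Path.source _, fun w => Path.target _⟩

theorem IsLocallyTrivialFibration.continuous {E B X : Type*} [TopologicalSpace E]
    [TopologicalSpace B] [TopologicalSpace X] {p : E → B} (hp : IsLocallyTrivialFibration X p) :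
    Continuous p := by
  rw [continuous_iff_continuousAt]
  intro e
  obtain ⟨τ, hτ⟩ := hp (p e)
  exact τ.continuousAt_proj (τ.mem_source.2 hτ)

theorem IsLocallyTrivialFibration.metrizableSpace_fibre {E B X : Type*} [TopologicalSpace E]
    [TopologicalSpace B] [TopologicalSpace X] [TopologicalSpace.MetrizableSpace E] [Nonempty B]
    {p : E → B} (hp : IsLocallyTrivialFibration X p) : TopologicalSpace.MetrizableSpace X := by
  obtain ⟨b⟩ := ‹Nonempty B›
  obtain ⟨τ, hτ⟩ := hp b
  exact (τ.preimageSingletonHomeomorph hτ).symm.isEmbedding.metrizableSpace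

theorem Bundle.Trivialization.continuousAt_snd_comp {E B X Y : Type*} [TopologicalSpace E]
    [TopologicalSpace B] [TopologicalSpace X] [TopologicalSpace Y] {p : E → B}
    (τ : Bundle.Trivialization X p) {g : Y → E} {y : Y} (hg : ContinuousAt g y)
    (hy : p (g y) ∈ τ.baseSet) : ContinuousAt (fun y => (τ (g y)).2) y :=
  continuous_snd.continuousAt.comp
    (ContinuousAt.comp (g := τ) (τ.continuousAt (τ.mem_source.2 hy)) hg)

theorem IsLocallyTrivialFibration.exists_local_section {E B X : Type*} [TopologicalSpace E]
    [TopologicalSpace B] [TopologicalSpace X] [PathConnectedSpace X]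
    (hX : SemilocallyContractible X) {p : E → B} (hp : IsLocallyTrivialFibration X p)
    (z : {z : E × E // p z.1 = p z.2}) :
    ∃ N ∈ 𝓝 z, ∃ s : {z : E × E // p z.1 = p z.2} → FibrewisePath p, ContinuousOn s N ∧
      ∀ y ∈ N, fibrewiseEndpoints p (s y) = y := by
  classical
  obtain ⟨τ, hτ⟩ := hp (p z.1.1)
  have hpc := hp.continuous
  obtain ⟨V, hV, V', hV', γ, hγ, hγ0, hγ1⟩ :=
    hX.exists_local_paths (τ z.1.1).2 (τ z.1.2).2
  let S : Set {z : E × E // p z.1 = p z.2} :=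
    {y | p y.1.1 ∈ τ.baseSet ∧ (τ y.1.1).2 ∈ V ∧ (τ y.1.2).2 ∈ V'}
  have c1 : ∀ y : {z : E × E // p z.1 = p z.2}, p y.1.1 ∈ τ.baseSet →
      ContinuousAt (fun y : {z : E × E // p z.1 = p z.2} => (τ y.1.1).2) y := fun y hy =>
    τ.continuousAt_snd_comp (continuous_fst.comp continuous_subtype_val).continuousAt hy
  have c2 : ∀ y : {z : E × E // p z.1 = p z.2}, p y.1.1 ∈ τ.baseSet →
      ContinuousAt (fun y : {z : E × E // p z.1 = p z.2} => (τ y.1.2).2) y := fun y hy =>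
    τ.continuousAt_snd_comp (continuous_snd.comp continuous_subtype_val).continuousAt (y.2 ▸ hy)
  have hpc1 : Continuous fun y : {z : E × E // p z.1 = p z.2} => p y.1.1 :=
    hpc.comp (continuous_fst.comp continuous_subtype_val)
  have hS : S ∈ 𝓝 z := by
    filter_upwards [hpc1.continuousAt.preimage_mem_nhds (τ.open_baseSet.mem_nhds hτ),
      (c1 z hτ).preimage_mem_nhds hV, (c2 z hτ).preimage_mem_nhds hV'] with y h1 h2 h3
    exact ⟨h1, h2, h3⟩
  let w : S → V × V' := fun y => (⟨(τ y.1.1.1).2, y.2.2.1⟩, ⟨(τ y.1.1.2).2, y.2.2.2⟩)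
  have hw : Continuous w := by
    refine Continuous.prodMk (Continuous.subtype_mk ?_ _) (Continuous.subtype_mk ?_ _)
    · exact continuous_iff_continuousAt.2 fun y =>
        (c1 y.1 y.2.1).comp continuous_subtype_val.continuousAt
    · exact continuous_iff_continuousAt.2 fun y =>
        (c2 y.1 y.2.1).comp continuous_subtype_val.continuousAt
  let g : C(S × I, E) :=
    { toFun := fun q => τ.toOpenPartialHomeomorph.symm (p q.1.1.1.1, γ (w q.1, q.2))
      continuous_toFun := by
        refine τ.toOpenPartialHomeomorph.continuousOn_symm.comp_continuous ?_ fun q => ?_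
        · exact (hpc1.comp (continuous_subtype_val.comp continuous_fst)).prodMk
            (hγ.comp ((hw.comp continuous_fst).prodMk continuous_snd))
        · exact τ.mem_target.2 q.1.2.1 }
  have hpg : ∀ q, p (g q) = p q.1.1.1.1 := fun q => τ.proj_symm_apply' q.1.2.1
  let c : S → FibrewisePath p := fun y => ⟨g.curry y, fun t => (hpg (y, t)).trans (hpg (y, 0)).symm⟩
  have hc : Continuous c := g.curry.continuous.subtype_mk _
  refine ⟨S, hS, fun y => if h : y ∈ S then c ⟨y, h⟩ else ⟨ContinuousMap.const I y.1.1, by simp⟩,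
    ?_, fun y hy => ?_⟩
  · rw [continuousOn_iff_continuous_domRestrict]
    convert hc using 1
    funext y
    simp
  · simp only [dif_pos hy]
    refine Subtype.ext (Prod.ext ?_ ?_)
    · change τ.toOpenPartialHomeomorph.symm (p y.1.1, γ (w ⟨y, hy⟩, 0)) = y.1.1
      rw [hγ0]
      exact τ.symm_apply_mk_proj (τ.mem_source.2 hy.1)
    · change τ.toOpenPartialHomeomorph.symm (p y.1.1, γ (w ⟨y, hy⟩, 1)) = y.1.2
      rw [hγ1, y.2]
      exact τ.symm_apply_mk_proj (τ.mem_source.2 (y.2 ▸ hy.1))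

/-! ### Zero-dimensional decomposition of the fibre product -/

theorem ZeroDimOn.preimage_fibreProduct {E B X : Type*} [TopologicalSpace E]
    [TopologicalSpace B] [TopologicalSpace X] {p : E → B} (hpc : Continuous p)
    (τ : B → Bundle.Trivialization X p) {f : B → B} {O : Set B} (hO : IsOpen O)
    (hf : LocConstOn f O) (hτ : ∀ b ∈ O, b ∈ (τ (f b)).baseSet) {Z : Set (B × X × X)}
    (hZ : ZeroDimOn Z) :
    ZeroDimOn {y : {z : E × E // p z.1 = p z.2} | p y.1.1 ∈ O ∧
      (p y.1.1, (τ (f (p y.1.1)) y.1.1).2, (τ (f (p y.1.1)) y.1.2).2) ∈ Z} := by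
  have hpc1 : Continuous fun y : {z : E × E // p z.1 = p z.2} => p y.1.1 :=
    hpc.comp (continuous_fst.comp continuous_subtype_val)
  have hf' : ∀ b ∈ O, ∀ᶠ b' in 𝓝 b, f b' = f b := fun b hb => by
    have := hf b hb
    rwa [hO.nhdsWithin_eq hb] at this
  refine hZ.comap (fun y => (p y.1.1, (τ (f (p y.1.1)) y.1.1).2, (τ (f (p y.1.1)) y.1.2).2))
    (fun y hy => hy.2) (fun y hy => ContinuousAt.continuousWithinAt ?_) fun y hy V hV => ?_
  · have h1 : p y.1.1 ∈ (τ (f (p y.1.1))).baseSet := hτ _ hy.1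
    have h2 : ContinuousAt (fun y' : {z : E × E // p z.1 = p z.2} =>
        (p y'.1.1, (τ (f (p y.1.1)) y'.1.1).2, (τ (f (p y.1.1)) y'.1.2).2)) y := by
      refine hpc1.continuousAt.prodMk (ContinuousAt.prodMk ?_ ?_)
      · exact (τ _).continuousAt_snd_comp
          (continuous_fst.comp continuous_subtype_val).continuousAt h1
      · exact (τ _).continuousAt_snd_comp
          (continuous_snd.comp continuous_subtype_val).continuousAt (y.2 ▸ h1)
    refine h2.congr ?_
    filter_upwards [hpc1.continuousAt.eventually (hf' _ hy.1)] with y' hy'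
    rw [hy']
  · have h1 : p y.1.1 ∈ (τ (f (p y.1.1))).baseSet := hτ _ hy.1
    obtain ⟨U, hU, hUV⟩ := (mem_nhds_subtype _ _ _).1 hV
    obtain ⟨V₁, hV₁, V₂, hV₂, hVU⟩ := mem_nhds_prod_iff.1 hU
    rw [(τ (f (p y.1.1))).nhds_eq_inf_comap ((τ _).mem_source.2 h1),
      mem_inf_iff_superset] at hV₁
    rw [(τ (f (p y.1.1))).nhds_eq_inf_comap ((τ _).mem_source.2 (y.2 ▸ h1)),
      mem_inf_iff_superset, ← y.2] at hV₂
    obtain ⟨_, ⟨A₁, hA₁, hA₁'⟩, _, ⟨C₁, hC₁, hC₁'⟩, hAC₁⟩ := hV₁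
    obtain ⟨_, ⟨A₂, hA₂, hA₂'⟩, _, ⟨C₂, hC₂, hC₂'⟩, hAC₂⟩ := hV₂
    -- The base neighbourhood also fixes the value of `f`, so both points are read in the same
    -- chart, where base and fibre coordinates determine the topology.
    refine ⟨((A₁ ∩ A₂) ∩ {b | f b = f (p y.1.1)}) ×ˢ (C₁ ×ˢ C₂),
      prod_mem_nhds (inter_mem (inter_mem hA₁ hA₂) (hf' _ hy.1)) (prod_mem_nhds hC₁ hC₂), ?_⟩
    rintro y' - ⟨⟨⟨hy₁, hy₂⟩, hfy⟩, hz₁, hz₂⟩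
    simp only [mem_ofPred_eq] at hfy
    simp only [hfy] at hz₁ hz₂
    refine hUV (hVU ⟨hAC₁ ⟨hA₁' hy₁, hC₁' hz₁⟩, hAC₂ ⟨hA₂' ?_, hC₂' hz₂⟩⟩)
    rw [mem_preimage, ← y'.2]
    exact hy₂

/-- On `A i` a locally constant function selects which local section to use. It extends to an open
neighbourhood, and the chosen sections form a continuous one because the choice does not vary
locally. -/
theorem hasSectionalCover_of_zeroDimOn {Z Y : Type*} [TopologicalSpace Z] [TopologicalSpace Y]
    [TopologicalSpace.MetrizableSpace Y] {q : Z → Y} {k : ℕ} (A : Fin (k + 1) → Set Y)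
    (hA : ∀ i, ZeroDimOn (A i)) (hAc : ⋃ i, A i = univ)
    (hq : ∀ y, ∃ N ∈ 𝓝 y, ∃ s : Y → Z, ContinuousOn s N ∧ ∀ y' ∈ N, q (s y') = y') :
    HasSectionalCover q k := by
  choose N hN s hs hqs using hq
  have h1 : ∀ i, ∃ U : Set Y, IsOpen U ∧ A i ⊆ U ∧ ∃ t : C(U, Z), ∀ y : U, q (t y) = y := by
    intro i
    obtain ⟨f, hf, -, hfN⟩ := (hA i).exists_refinement (fun y => interior (N y))
      fun y _ => interior_mem_nhds.2 (hN y)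
    obtain ⟨O, g, hO, hAO, hg, hgf⟩ := hf.extend
    let U : Set Y := {y ∈ O | y ∈ interior (N (g y))}
    refine ⟨U, hg.isOpen hO (P := fun a => interior (N a)) fun _ => isOpen_interior,
      fun y hy => ⟨hAO hy, by rw [hgf hy]; exact hfN y hy⟩,
      ⟨U.domRestrict fun y => s (g y) y, ?_⟩, fun y => hqs (g y) y (interior_subset y.2.2)⟩
    rw [← continuousOn_iff_continuous_domRestrict]
    intro y hy
    have h2 := hg y hy.1
    rw [hO.nhdsWithin_eq hy.1] at h2
    refine ContinuousAt.continuousWithinAt ?_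
    refine ((hs (g y)).continuousAt (mem_interior_iff_mem_nhds.1 hy.2)).congr ?_
    filter_upwards [h2] with y' hy'
    rw [hy']
  choose U hU hAU t ht using h1
  exact ⟨U, hU, univ_subset_iff.1 (hAc.ge.trans (iUnion_mono hAU)), fun i => ⟨t i, ht i⟩⟩

theorem IsLocallyTrivialFibration.hasSectionalCover {E B X : Type*} [TopologicalSpace E]
    [TopologicalSpace B] [TopologicalSpace X] [TopologicalSpace.MetrizableSpace E]
    [TopologicalSpace.MetrizableSpace B] [Nonempty B] [PathConnectedSpace X]
    (hX : SemilocallyContractible X) {p : E → B} (hp : IsLocallyTrivialFibration X p) {n d : ℕ}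
    (hXn : HasCoveringDimLE X n) (hBd : HasCoveringDimLE B d) :
    HasSectionalCover (fibrewiseEndpoints p) (2 * n + d) := by
  have := hp.metrizableSpace_fibre
  have : TopologicalSpace.MetrizableSpace {z : E × E // p z.1 = p z.2} :=
    Topology.IsEmbedding.subtypeVal.metrizableSpace
  have hpc := hp.continuous
  obtain ⟨r, hr, hrn⟩ := hXn.exists_isDimRank
  obtain ⟨s, hs, hsd⟩ := hBd.exists_isDimRank
  have hR := hs.prod (hr.prod hr)
  choose τ hτ using hp
  obtain ⟨O, f, hO, hOc, hf, hfτ⟩ := hBd.exists_coloring (fun b => (τ b).baseSet)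
    (fun b => (τ b).open_baseSet) hτ
  obtain ⟨C, hCc, hC, hCO⟩ := exists_iUnion_eq_closed_subset hO (fun x => toFinite _) hOc
  have hJ : ∀ b, ∃ j, b ∈ C j ∧ ∀ j' < j, b ∉ C j' := by
    intro b
    obtain ⟨j, hj⟩ := mem_iUnion.1 (hCc.ge (mem_univ b))
    obtain ⟨j, hj, hmin⟩ := wellFounded_lt.has_min {j | b ∈ C j} ⟨j, hj⟩
    exact ⟨j, hj, fun j' hj' h => hmin j' h hj'⟩
  choose J hJC hJmin using hJ
  have hJu : ∀ b j, b ∈ C j → (∀ j' < j, b ∉ C j') → J b = j := by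
    intro b j hj hmin
    rcases lt_trichotomy (J b) j with h | h | h
    · exact absurd (hJC b) (hmin _ h)
    · exact h
    · exact absurd hj (hJmin b _ h)
  -- The fibre ranks are read in a chart chosen via the least `j` with `p y.1.1 ∈ C j`. They may
  -- jump between pieces of the base, which is harmless: only zero-dimensionality of the levels is
  -- needed, and it is checked piece by piece.
  let R : {z : E × E // p z.1 = p z.2} → ℕ := fun y =>
    s (p y.1.1) + (r (τ (f (J (p y.1.1)) (p y.1.1)) y.1.1).2 +
      r (τ (f (J (p y.1.1)) (p y.1.1)) y.1.2).2)
  have hpc1 : Continuous fun y : {z : E × E // p z.1 = p z.2} => p y.1.1 :=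
    hpc.comp (continuous_fst.comp continuous_subtype_val)
  refine hasSectionalCover_of_zeroDimOn (fun k => {y | R y = k}) (fun k => ?_) ?_
    (IsLocallyTrivialFibration.exists_local_section hX fun b => ⟨τ b, hτ b⟩)
  · refine ZeroDimOn.of_countable_cover
      (fun j => (fun y => p y.1.1) ⁻¹' (C j ∩ ⋂ j' ∈ Iio j, (C j')ᶜ)) (fun j => ?_) ?_ fun j => ?_
    · rw [← preimage_compl]
      -- A difference of closed sets is F_σ: its complement is an open set together with finitely
      -- many closed sets, and closed sets are G_δ by metrisability.
      refine IsGδ.preimage hpc1 ?_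
      rw [compl_inter, compl_iInter₂]
      simp only [compl_compl]
      exact (hC j).isOpen_compl.isGδ.union (IsGδ.biUnion (toFinite _) fun j' _ => (hC j').isGδ)
    · intro y _
      exact mem_iUnion.2 ⟨J (p y.1.1), hJC _, mem_iInter₂.2 fun j' hj' => hJmin _ j' hj'⟩
    · refine (ZeroDimOn.preimage_fibreProduct hpc τ (hO j) (hf j) (hfτ j)
        (hR.zeroDimOn k)).mono ?_
      rintro y ⟨hy, hyC, hyj⟩
      have h1 := hJu _ j hyC fun j' hj' => mem_iInter₂.1 hyj j' hj'
      have hy' : R y = k := hy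
      simp only [R, h1] at hy'
      exact ⟨hCO j hyC, hy'⟩
  · refine eq_univ_of_forall fun y => mem_iUnion.2 ⟨⟨R y, ?_⟩, rfl⟩
    have h1 := hsd (p y.1.1)
    have h2 := hrn (τ (f (J (p y.1.1)) (p y.1.1)) y.1.1).2
    have h3 := hrn (τ (f (J (p y.1.1)) (p y.1.1)) y.1.2).2
    simp only [R]
    omega

theorem exists_coveringDim_eq {Y : Type*} [TopologicalSpace Y] (h : coveringDim Y ≠ ⊤) :
    ∃ n : ℕ, HasCoveringDimLE Y n ∧ coveringDim Y = n := by
  classical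
  have h1 : ∃ n, HasCoveringDimLE Y n := by
    by_contra! hne
    exact h (by simp [coveringDim, hne])
  refine ⟨Nat.find h1, Nat.find_spec h1, le_antisymm (iInf₂_le _ (Nat.find_spec h1)) ?_⟩
  exact le_iInf₂ fun m hm => by exact_mod_cast Nat.find_min' h1 hm

theorem proposition7p1 {E B X : Type*} [TopologicalSpace E] [TopologicalSpace B]
    [TopologicalSpace X] [TopologicalSpace.MetrizableSpace E] [TopologicalSpace.MetrizableSpace B]
    [Nonempty B] [PathConnectedSpace X] (hX : SemilocallyContractible X)
    (p : E → B) (hp : IsLocallyTrivialFibration X p) :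
    parametrizedTC p ≤ 2 * coveringDim X + coveringDim B := by
  by_cases hB : coveringDim B = ⊤
  · simp [hB]
  by_cases hXd : coveringDim X = ⊤
  · simp [hXd]
  obtain ⟨d, hd, hd'⟩ := exists_coveringDim_eq hB
  obtain ⟨n, hn, hn'⟩ := exists_coveringDim_eq hXd
  rw [hd', hn']
  exact (iInf₂_le (2 * n + d) (hp.hasSectionalCover hX hn hd)).trans (by simp)
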